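/- Let $N\ge 2$, let $Y=[0,1]^N$, and let $F\subset\mathbb R^N$ be open with $\bar F\subset Y$ and with $C^1$ boundary (locally, $F$ lies strictly on one side of a $C^1$ graph). Assume that the holes do not touch one another, that is, $\bar F\cap(k+\bar F)=\varnothing$ for every $k\in\mathbb Z^N\setminus\{0\}$ (this is automatic if $\bar F\subset(0,1)^N$). For an open set $\Omega\subset\mathbb R^N$ and $\varepsilon>0$ put $Y_{k,\varepsilon}=\varepsilon k+\varepsilon Y$ and $F_{k,\varepsilon}=\varepsilon k+\varepsilon F$ for $k\in\mathbb Z^N$, and $$F_\varepsilon=\bigcup\{F_{k,\varepsilon}:\ k\in\mathbb Z^N,\ Y_{k,\varepsilon}\cap\Omega\neq\varnothing,\ \bar F_{k,\varepsilon}\subset\Omega\},\qquad \Omega_\varepsilon=\Omega\setminus\bar F_\varepsilon .$$ Then for every $1\le p<\infty$ there is a constant $C>0$, depending only on $N$, $p$ and $F$ (in particular independent of $\varepsilon$), such that for every bounded connected open set $\Omega\subset\mathbb R^N$ with $C^1$ boundary, every $\varepsilon>0$ and every real-valued $v\in W^{1,p}(\Omega_\varepsilon)$ whose trace $\gamma_0(v)$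 vanishes almost everywhere on $\partial\Omega$, $$\varepsilon\,\|\gamma_0(v)\|_{L^p(\partial F_\varepsilon)}^p\le C\left(\|v\|_{L^p(\Omega_\varepsilon)}^p+\varepsilon^p\,\|\nabla v\|_{L^p(\Omega_\varepsilon)}^p\right).$$ Here $\gamma_0(v)\in L^p(\partial\Omega_\varepsilon)$ is the trace of $v$ on $\partial\Omega_\varepsilon$, that is, the limit in $L^p(\partial\Omega_\varepsilon)$ (with respect to the $(N-1)$-dimensional surface measure) of $u_m|_{\partial\Omega_\varepsilon}$ for smooth functions $u_m\in C^\infty(\mathbb R^N)$ with $u_m\to v$ in $W^{1,p}(\Omega_\varepsilon)$. -/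

import Mathlib

open MeasureTheory Set Filter Topology
open scoped ENNReal ContDiff

noncomputable section

/-- `U ⊆ ℝᴺ` has `C¹` boundary: near each boundary point, for a suitable unit vector `n`, the set
`U` is the part lying strictly on one side of the graph, over the hyperplane orthogonal to `n`, of
a `C¹` function (only the values of `γ` on that hyperplane are used). -/
def HasC1Boundary {N : ℕ} (U : Set (EuclideanSpace ℝ (Fin N))) : Prop :=
  ∀ x₀ ∈ frontier U, ∃ r : ℝ, 0 < r ∧
    ∃ (n : EuclideanSpace ℝ (Fin N)) (γ : EuclideanSpace ℝ (Fin N) → ℝ),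
      ‖n‖ = 1 ∧ ContDiff ℝ 1 γ ∧
      U ∩ Metric.ball x₀ r =
        {x | γ (x - inner ℝ n x • n) < inner ℝ n x} ∩ Metric.ball x₀ r

/-- The `(N-1)`-dimensional surface measure on a subset `S` of `ℝᴺ` (Hausdorff measure, normalised
so that it agrees with Lebesgue measure on hyperplanes). -/
def surfaceMeasure {N : ℕ} (S : Set (EuclideanSpace ℝ (Fin N))) :
    Measure (EuclideanSpace ℝ (Fin N)) :=
  (Measure.euclideanHausdorffMeasure (N - 1)).restrict S

/-- `G` is the weak gradient of `v` in the open set `U`, tested against `C_c^∞(U)`. -/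
def HasWeakGradient {N : ℕ} (U : Set (EuclideanSpace ℝ (Fin N)))
    (v : EuclideanSpace ℝ (Fin N) → ℝ)
    (G : EuclideanSpace ℝ (Fin N) → EuclideanSpace ℝ (Fin N)) : Prop :=
  ∀ φ : EuclideanSpace ℝ (Fin N) → ℝ, ContDiff ℝ ∞ φ → HasCompactSupport φ → tsupport φ ⊆ U →
    ∀ i : Fin N,
      ∫ x in U, v x * gradient φ x i = - ∫ x in U, G x i * φ x

/-- `v ∈ W^{1,p}(U)`, with weak gradient `G`. -/
structure IsW1p {N : ℕ} (p : ℝ≥0∞) (U : Set (EuclideanSpace ℝ (Fin N)))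
    (v : EuclideanSpace ℝ (Fin N) → ℝ)
    (G : EuclideanSpace ℝ (Fin N) → EuclideanSpace ℝ (Fin N)) : Prop where
  memLp : MemLp v p (volume.restrict U)
  memLp_grad : MemLp G p (volume.restrict U)
  weakGradient : HasWeakGradient U v G

/-- `g` is the trace on `∂U` of `v ∈ W^{1,p}(U)` (with weak gradient `G`): `g` is the limit in
`L^p(∂U)` of the restrictions to `∂U` of smooth functions that converge to `v` in `W^{1,p}(U)`. -/
def IsTrace {N : ℕ} (p : ℝ≥0∞) (U : Set (EuclideanSpace ℝ (Fin N)))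
    (v : EuclideanSpace ℝ (Fin N) → ℝ)
    (G : EuclideanSpace ℝ (Fin N) → EuclideanSpace ℝ (Fin N))
    (g : EuclideanSpace ℝ (Fin N) → ℝ) : Prop :=
  MemLp g p (surfaceMeasure (frontier U)) ∧
  ∃ u : ℕ → EuclideanSpace ℝ (Fin N) → ℝ,
    (∀ m, ContDiff ℝ ∞ (u m)) ∧
    Tendsto (fun m => eLpNorm (u m - v) p (volume.restrict U)) atTop (𝓝 0) ∧
    Tendsto (fun m => eLpNorm (gradient (u m) - G) p (volume.restrict U)) atTop (𝓝 0) ∧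
    Tendsto (fun m => eLpNorm (u m - g) p (surfaceMeasure (frontier U))) atTop (𝓝 0)

/-- The closed unit cell `Y = [0,1]ᴺ`. -/
def unitCell (N : ℕ) : Set (EuclideanSpace ℝ (Fin N)) :=
  {y | ∀ i, y i ∈ Icc (0 : ℝ) 1}

/-- An integer vector `k ∈ ℤᴺ`, seen in `ℝᴺ`. -/
def latticeVec {N : ℕ} (k : Fin N → ℤ) : EuclideanSpace ℝ (Fin N) :=
  WithLp.toLp 2 fun i => (k i : ℝ)

/-- The rescaled translate `ε k + ε S`. -/
def scaledCopy {N : ℕ} (ε : ℝ) (k : Fin N → ℤ) (S : Set (EuclideanSpace ℝ (Fin N))) :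
    Set (EuclideanSpace ℝ (Fin N)) :=
  (fun y => ε • latticeVec k + ε • y) '' S

/-- The union `F_ε` of the holes `ε k + ε F` whose closure is contained in `Ω`, where `k` runs over
the integer vectors whose cell `ε k + ε Y` meets `Ω`. -/
def holes {N : ℕ} (Ω F : Set (EuclideanSpace ℝ (Fin N))) (ε : ℝ) :
    Set (EuclideanSpace ℝ (Fin N)) :=
  ⋃ k ∈ {k : Fin N → ℤ | (scaledCopy ε k (unitCell N) ∩ Ω).Nonempty ∧
    closure (scaledCopy ε k F) ⊆ Ω}, scaledCopy ε k F

/-- The perforated domain `Ω_ε = Ω \ closure F_ε`. -/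
def perforated {N : ℕ} (Ω F : Set (EuclideanSpace ℝ (Fin N))) (ε : ℝ) :
    Set (EuclideanSpace ℝ (Fin N)) :=
  Ω \ closure (holes Ω F ε)

end

/-! A boundary point of a hole is joined to the perforated domain by a short segment leaving the
hole along `-n`. If the segment stays in `Ω`, the fundamental theorem of calculus and averaging
bound `|u|^p` at its start by an integral along it. A hole may lie arbitrarily close to `∂Ω`, so the
segment may exit; then the value of `u` at the first exit point is added, and that point lies on
`∂Ω`. For fixed `F`, integrating over charts gives a trace inequality with a constant uniform in the
ambient open set `W`, at the price of a surface integral over `∂W` (`exists_lintegral_frontier_le`).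

Scaling gives each hole the weights `ε` and `ε^p` (`lintegral_frontier_dilation_le`). The collars of
distinct holes are disjoint (`exists_disjoint_scaledCopy_thickening`), so the volume terms add up
without loss. The terms on `∂Ω` add up to a factor `M` depending on `Ω` and `ε`. This is harmless:
along the smooth approximations of `v` the integral over `∂Ω` tends to zero, since the trace
vanishes there. -/

/-! ### Surface integrals under Lipschitz maps -/

theorem LipschitzOnWith.euclideanHausdorffMeasure_image_le {X Y : Type*} [EMetricSpace X]
    [MeasurableSpace X] [BorelSpace X] [EMetricSpace Y] [MeasurableSpace Y] [BorelSpace Y]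
    {K : NNReal} {f : X → Y} {s : Set X} (h : LipschitzOnWith K f s) (d : ℕ) :
    Measure.euclideanHausdorffMeasure d (f '' s) ≤
      (K : ℝ≥0∞) ^ d * Measure.euclideanHausdorffMeasure d s := by
  have := h.hausdorffMeasure_image_le (d := (d : ℝ)) (by positivity)
  simp only [Measure.euclideanHausdorffMeasure_def, Measure.smul_apply, ENNReal.smul_def,
    smul_eq_mul]
  rw [ENNReal.rpow_natCast] at this
  rw [mul_left_comm]
  gcongr

/-- Comparison of surface integrals under a Lipschitz map: no measurability of the function on the
target is needed. -/
theorem LipschitzOnWith.lintegral_euclideanHausdorffMeasure_le {X Y : Type*} [EMetricSpace X]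
    [MeasurableSpace X] [BorelSpace X] [EMetricSpace Y] [MeasurableSpace Y] [BorelSpace Y]
    {K : NNReal} {f : X → Y} {s : Set X} (h : LipschitzOnWith K f s) (hf : Measurable f)
    (hs : MeasurableSet s) (d : ℕ) {a : Y → ℝ≥0∞} {b : X → ℝ≥0∞} (hb : Measurable b)
    (hab : ∀ y, a y ≠ 0 → ∃ x ∈ s, f x = y ∧ a y ≤ b x) :
    ∫⁻ y, a y ∂(Measure.euclideanHausdorffMeasure d) ≤
      (K : ℝ≥0∞) ^ d * ∫⁻ x in s, b x ∂(Measure.euclideanHausdorffMeasure d) := by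
  -- The integral is a supremum over simple functions `φ ≤ a`, so only `φ` has to be measurable. On
  -- each level set of `φ` the measures are compared through the points of `s` where `φ ∘ f ≤ b`.
  rw [lintegral]
  refine iSup₂_le fun φ hφ => ?_
  set T : Set X := s ∩ {x | φ (f x) ≤ b x}
  have hT : MeasurableSet T := hs.inter (measurableSet_le (φ.measurable.comp hf) hb)
  have key : ∫⁻ x in T, φ (f x) ∂(Measure.euclideanHausdorffMeasure d) ≤
      ∫⁻ x in s, b x ∂(Measure.euclideanHausdorffMeasure d) :=
    (setLIntegral_mono hb fun x hx => hx.2).trans (lintegral_mono_set inter_subset_left)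
  refine le_trans ?_ (mul_le_mul_right key _)
  rw [← lintegral_map φ.measurable hf, SimpleFunc.lintegral_eq_lintegral, SimpleFunc.lintegral,
    SimpleFunc.lintegral, Finset.mul_sum]
  refine Finset.sum_le_sum fun c hc => ?_
  rcases eq_or_ne c 0 with rfl | hc0
  · simp
  rw [mul_left_comm, Measure.map_apply hf (φ.measurableSet_fiber c),
    Measure.restrict_apply (hf (φ.measurableSet_fiber c))]
  gcongr
  refine le_trans (measure_mono ?_)
    ((h.mono (s := f ⁻¹' (φ ⁻¹' {c}) ∩ T) fun x hx => hx.2.1).euclideanHausdorffMeasure_image_le d)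
  intro y hy
  have hy' : φ y = c := hy
  obtain ⟨x, hx, rfl, hle⟩ := hab y (fun h0 => hc0 (by
    have := hφ y; simp only [h0] at this; rw [← hy']; simpa using this))
  exact ⟨x, ⟨hy, hx, (hφ _).trans hle⟩, rfl⟩

/-! ### Estimates on a segment -/

theorem lintegral_rpow_le_lintegral_rpow {α : Type*} [MeasurableSpace α] {μ : Measure α}
    (hμ : μ univ ≤ 1) {p : ℝ} (hp : 1 ≤ p) {f : α → ℝ} (hf : AEStronglyMeasurable f μ) :
    (∫⁻ x, ‖f x‖ₑ ∂μ) ^ p ≤ ∫⁻ x, ‖f x‖ₑ ^ p ∂μ := by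
  have h := eLpNorm'_le_eLpNorm'_mul_rpow_measure_univ (μ := μ) one_pos hp hf
  simp only [eLpNorm', ENNReal.rpow_one, div_one, one_div] at h
  have h1 : μ univ ^ (1 - p⁻¹) ≤ 1 :=
    ENNReal.rpow_le_one hμ (by rw [sub_nonneg]; exact inv_le_one_of_one_le₀ hp)
  have h2 := h.trans (mul_le_of_le_one_right (zero_le) h1)
  exact (ENNReal.le_rpow_inv_iff (by linarith)).1 h2

theorem enorm_rpow_le_of_contDiff {φ : ℝ → ℝ} (hφ : ContDiff ℝ 1 φ) {p : ℝ} (hp : 1 ≤ p) {t : ℝ}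
    (ht : t ∈ Icc (0 : ℝ) 1) :
    ‖φ 0‖ₑ ^ p ≤ 2 ^ (p - 1) * (‖φ t‖ₑ ^ p + ∫⁻ s in Ioo 0 t, ‖deriv φ s‖ₑ ^ p) := by
  have hcont : Continuous (deriv φ) := hφ.continuous_deriv le_rfl
  have hftc : ∫ s in Ioo 0 t, deriv φ s = φ t - φ 0 := by
    rw [← integral_Ioc_eq_integral_Ioo, ← intervalIntegral.integral_of_le ht.1]
    exact intervalIntegral.integral_deriv_eq_sub
      (fun x _ => (hφ.differentiable one_ne_zero).differentiableAt) (hcont.intervalIntegrable _ _)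
  have h1 : ‖φ 0‖ₑ ≤ ‖φ t‖ₑ + ∫⁻ s in Ioo 0 t, ‖deriv φ s‖ₑ := by
    have : φ 0 = φ t - ∫ s in Ioo 0 t, deriv φ s := by rw [hftc]; ring
    rw [this]
    exact (enorm_sub_le).trans (by gcongr; exact enorm_integral_le_lintegral_enorm _)
  calc ‖φ 0‖ₑ ^ p ≤ (‖φ t‖ₑ + ∫⁻ s in Ioo 0 t, ‖deriv φ s‖ₑ) ^ p := by gcongr
    _ ≤ 2 ^ (p - 1) * (‖φ t‖ₑ ^ p + (∫⁻ s in Ioo 0 t, ‖deriv φ s‖ₑ) ^ p) :=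
      ENNReal.rpow_add_le_mul_rpow_add_rpow _ _ hp
    _ ≤ _ := by
      gcongr
      refine lintegral_rpow_le_lintegral_rpow ?_ hp hcont.aestronglyMeasurable
      simpa using ht.2

/-- Either `[0, δ]` stays in `O`, and `enorm_rpow_le_of_contDiff` is averaged over `t ∈ (0, δ)`, or
it leaves `O`, and that bound is used at the first exit time. In both cases only values inside `O`
are integrated. -/
theorem enorm_rpow_le_of_isOpen {φ : ℝ → ℝ} (hφ : ContDiff ℝ 1 φ) {p : ℝ} (hp : 1 ≤ p)
    {O : Set ℝ} (hO : IsOpen O) (h0 : (0 : ℝ) ∈ O) {δ : ℝ} (hδ : 0 < δ) (hδ1 : δ ≤ 1) :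
    (∃ t ∈ Ioc 0 δ, t ∈ frontier O ∧ ‖φ 0‖ₑ ^ p ≤ 2 ^ (p - 1) * ‖φ t‖ₑ ^ p +
      2 ^ (p - 1) * (ENNReal.ofReal δ)⁻¹ *
        ∫⁻ s in Ioo 0 δ ∩ O, (‖φ s‖ₑ ^ p + ‖deriv φ s‖ₑ ^ p)) ∨
    ‖φ 0‖ₑ ^ p ≤ 2 ^ (p - 1) * (ENNReal.ofReal δ)⁻¹ *
      ∫⁻ s in Ioo 0 δ ∩ O, (‖φ s‖ₑ ^ p + ‖deriv φ s‖ₑ ^ p) := by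
  have hcont : Continuous (deriv φ) := hφ.continuous_deriv le_rfl
  have hm1 : Measurable fun s => ‖φ s‖ₑ ^ p :=
    (hφ.continuous.measurable.enorm).pow_const p
  have hm2 : Measurable fun s => ‖deriv φ s‖ₑ ^ p := hcont.measurable.enorm.pow_const p
  have hδ0 : ENNReal.ofReal δ ≠ 0 := by simpa using hδ
  by_cases hsub : Icc 0 δ ⊆ O
  · right
    have hioo : Ioo 0 δ ∩ O = Ioo 0 δ := inter_eq_left.2 (Ioo_subset_Icc_self.trans hsub)
    rw [hioo, mul_right_comm, ← div_eq_mul_inv,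
      ENNReal.le_div_iff_mul_le (Or.inl hδ0) (Or.inl ENNReal.ofReal_ne_top)]
    calc ‖φ 0‖ₑ ^ p * ENNReal.ofReal δ = ∫⁻ t in Ioo 0 δ, ‖φ 0‖ₑ ^ p := by simp
      _ ≤ ∫⁻ t in Ioo 0 δ,
          2 ^ (p - 1) * (‖φ t‖ₑ ^ p + ∫⁻ s in Ioo 0 δ, ‖deriv φ s‖ₑ ^ p) := by
        refine setLIntegral_mono (by fun_prop) fun t ht => ?_
        refine (enorm_rpow_le_of_contDiff hφ hp ⟨ht.1.le, ht.2.le.trans hδ1⟩).trans ?_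
        gcongr
        exact ht.2.le
      _ = 2 ^ (p - 1) * ((∫⁻ t in Ioo 0 δ, ‖φ t‖ₑ ^ p) +
          (∫⁻ s in Ioo 0 δ, ‖deriv φ s‖ₑ ^ p) * ENNReal.ofReal δ) := by
        rw [lintegral_const_mul _ (by fun_prop), lintegral_add_left hm1]
        simp
      _ ≤ _ := by
        rw [lintegral_add_left hm1]
        gcongr
        refine mul_le_of_le_one_right (zero_le) ?_
        simpa using hδ1
  · left
    obtain ⟨x, hx, hxO⟩ := not_subset.1 hsub
    -- `T` is the first exit time: the least element of the compact set `[0, δ] \ O`.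
    obtain ⟨T, hT, hmin⟩ := (isCompact_Icc.diff hO).exists_isLeast ⟨x, hx, hxO⟩
    have hT0 : 0 < T := lt_of_le_of_ne hT.1.1 (fun h => hT.2 (h ▸ h0))
    have hIoo : Ioo 0 T ⊆ O := fun s hs => by
      by_contra hsO
      exact absurd (hmin ⟨⟨hs.1.le, hs.2.le.trans hT.1.2⟩, hsO⟩) (not_le.2 hs.2)
    refine ⟨T, ⟨hT0, hT.1.2⟩, ?_, ?_⟩
    · rw [hO.frontier_eq]
      refine ⟨closure_mono hIoo ?_, hT.2⟩
      rw [closure_Ioo hT0.ne]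
      exact ⟨hT0.le, le_rfl⟩
    · refine (enorm_rpow_le_of_contDiff hφ hp ⟨hT0.le, hT.1.2.trans hδ1⟩).trans ?_
      rw [mul_add]
      gcongr
      · refine le_mul_of_one_le_right (zero_le) ?_
        rw [ENNReal.one_le_inv]
        simpa using hδ1
      · exact fun s hs => ⟨⟨hs.1, hs.2.trans_le hT.1.2⟩, hIoo hs⟩
      · exact le_add_self

/-! ### Fubini along lines parallel to a unit vector -/

section Slicing

variable {E : Type*} [NormedAddCommGroup E] [InnerProductSpace ℝ E]

theorem coe_orthogonalProjectionOnto_orthogonal_span_singleton {n : E} (hn : ‖n‖ = 1) (x : E) :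
    (((ℝ ∙ n)ᗮ.orthogonalProjectionOnto x : (ℝ ∙ n)ᗮ) : E) = x - inner ℝ n x • n := by
  have := Submodule.starProjection_orthogonal_val (K := (ℝ ∙ n)) x
  rw [Submodule.starProjection_unit_singleton ℝ hn] at this
  exact this

theorem inner_add_smul_of_mem_orthogonal {n : E} (hn : ‖n‖ = 1) (y : (ℝ ∙ n)ᗮ) (s : ℝ) :
    inner ℝ n ((y : E) + s • n) = s := by
  have h1 : inner ℝ n (y : E) = 0 := Submodule.mem_orthogonal_singleton_iff_inner_right.1 y.2
  rw [inner_add_right, inner_smul_right, h1, real_inner_self_eq_norm_sq, hn]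
  ring

theorem orthogonalProjectionOnto_add_smul {n : E} (hn : ‖n‖ = 1) (y : (ℝ ∙ n)ᗮ) (s : ℝ) :
    (ℝ ∙ n)ᗮ.orthogonalProjectionOnto ((y : E) + s • n) = y := by
  ext1
  rw [coe_orthogonalProjectionOnto_orthogonal_span_singleton hn,
    inner_add_smul_of_mem_orthogonal hn, add_sub_cancel_right]

/-- Cartesian coordinates with respect to a unit vector and its orthogonal complement. -/
noncomputable def orthogonalCoordinates (n : E) (hn : ‖n‖ = 1) : ((ℝ ∙ n)ᗮ × ℝ) ≃L[ℝ] E where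
  toFun z := (z.1 : E) + z.2 • n
  invFun x := ((ℝ ∙ n)ᗮ.orthogonalProjectionOnto x, inner ℝ n x)
  map_add' z w := by simp only [Prod.fst_add, Prod.snd_add, Submodule.coe_add]; module
  map_smul' c z := by
    simp only [Prod.smul_fst, Prod.smul_snd, Submodule.coe_smul, RingHom.id_apply, smul_eq_mul]
    module
  left_inv z := Prod.ext (orthogonalProjectionOnto_add_smul hn z.1 z.2)
    (inner_add_smul_of_mem_orthogonal hn z.1 z.2)
  right_inv x := by
    simp only [coe_orthogonalProjectionOnto_orthogonal_span_singleton hn]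
    module
  continuous_toFun := by fun_prop
  continuous_invFun := by fun_prop

variable [FiniteDimensional ℝ E] [MeasurableSpace E] [BorelSpace E] {d : ℕ}
  [Fact (Module.finrank ℝ E = d + 1)]

/-- The product measure, carried to `E` by orthogonal coordinates, is a Haar measure, hence a
multiple of volume. The value of the factor is irrelevant. -/
theorem exists_lintegral_slices_eq {n : E} (hn : ‖n‖ = 1) :
    ∃ c : NNReal, ∀ f : E → ℝ≥0∞, Measurable f →
      ∫⁻ y : (ℝ ∙ n)ᗮ, (∫⁻ s : ℝ, f ((y : E) + s • n)) ∂(Measure.euclideanHausdorffMeasure d) =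
        c * ∫⁻ x, f x := by
  have hn0 : n ≠ 0 := by rintro rfl; simp at hn
  have hH : Measure.euclideanHausdorffMeasure (X := (ℝ ∙ n)ᗮ) d = volume := by
    rw [← InnerProductSpace.euclideanHausdorffMeasure_eq_volume,
      Submodule.finrank_orthogonal_span_singleton (n := d) hn0]
  rw [hH]
  set e := orthogonalCoordinates n hn
  set μ : Measure ((ℝ ∙ n)ᗮ × ℝ) := (volume : Measure (ℝ ∙ n)ᗮ).prod volume
  have : (μ.map e).IsAddHaarMeasure := e.isAddHaarMeasure_map μ
  refine ⟨(μ.map e).addHaarScalarFactor volume, fun f hf => ?_⟩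
  have hfe : Measurable fun z => f (e z) := hf.comp e.continuous.measurable
  have h1 : ∫⁻ x, f x ∂(μ.map e) = ∫⁻ z, f (e z) ∂μ := lintegral_map hf e.continuous.measurable
  have h2 := lintegral_prod (μ := (volume : Measure (ℝ ∙ n)ᗮ)) (ν := (volume : Measure ℝ))
    (fun z => f (e z)) hfe.aemeasurable
  rw [Measure.isAddLeftInvariant_eq_smul (μ.map e) volume, lintegral_smul_measure] at h1
  exact (h1.trans h2).symm

end Slicing

/-! ### Local graph geometry and the estimate along a line -/

section Graph

variable {E : Type*} [NormedAddCommGroup E] [InnerProductSpace ℝ E]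

theorem graph_le_of_mem_closure {F : Set E} {x₀ n : E} {r : ℝ} {γ : E → ℝ} (hγ : Continuous γ)
    (hloc : F ∩ Metric.ball x₀ r =
      {x | γ (x - inner ℝ n x • n) < inner ℝ n x} ∩ Metric.ball x₀ r)
    {x : E} (hx : x ∈ Metric.ball x₀ r) (hxF : x ∈ closure F) :
    γ (x - inner ℝ n x • n) ≤ inner ℝ n x := by
  by_contra! hlt
  have hopen : IsOpen ({x | inner ℝ n x < γ (x - inner ℝ n x • n)} ∩ Metric.ball x₀ r) :=
    (isOpen_lt (by fun_prop) (by fun_prop)).inter Metric.isOpen_ball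
  obtain ⟨z, ⟨hz1, hz2⟩, hzF⟩ := mem_closure_iff.1 hxF _ hopen ⟨hlt, hx⟩
  have : z ∈ F ∩ Metric.ball x₀ r := ⟨hzF, hz2⟩
  rw [hloc] at this
  exact lt_asymm (a := γ (z - inner ℝ n z • n)) this.1 hz1

theorem graph_eq_of_mem_frontier {F : Set E} (hF : IsOpen F) {x₀ n : E} {r : ℝ} {γ : E → ℝ}
    (hγ : Continuous γ)
    (hloc : F ∩ Metric.ball x₀ r =
      {x | γ (x - inner ℝ n x • n) < inner ℝ n x} ∩ Metric.ball x₀ r)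
    {x : E} (hx : x ∈ Metric.ball x₀ r) (hxF : x ∈ frontier F) :
    γ (x - inner ℝ n x • n) = inner ℝ n x := by
  rw [hF.frontier_eq] at hxF
  refine le_antisymm (graph_le_of_mem_closure hγ hloc hx hxF.1) ?_
  by_contra! hlt
  have : x ∈ F ∩ Metric.ball x₀ r := by rw [hloc]; exact ⟨hlt, hx⟩
  exact hxF.2 this.1

/-- Moving along `-n` lowers the height over an unchanged base point, hence drops strictly below the
graph; the bounds `r / 2` keep the point inside the chart. -/
theorem sub_smul_notMem_closure {F : Set E} (hF : IsOpen F) {x₀ n : E} (hn : ‖n‖ = 1) {r : ℝ}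
    {γ : E → ℝ} (hγ : Continuous γ)
    (hloc : F ∩ Metric.ball x₀ r =
      {x | γ (x - inner ℝ n x • n) < inner ℝ n x} ∩ Metric.ball x₀ r)
    {x : E} (hx : x ∈ Metric.closedBall x₀ (r / 2)) (hxF : x ∈ frontier F) {t : ℝ} (ht : 0 < t)
    (htr : t < r / 2) : x - t • n ∉ closure F := by
  intro hmem
  have hxb : x ∈ Metric.ball x₀ r := Metric.closedBall_subset_ball (by linarith) hx
  have hb : x - t • n ∈ Metric.ball x₀ r := by
    have h1 : dist (x - t • n) x = t := by
      rw [dist_eq_norm]; simp [norm_smul, hn, abs_of_pos ht]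
    have := dist_triangle (x - t • n) x x₀
    have := Metric.mem_closedBall.1 hx
    rw [Metric.mem_ball]; linarith
  have h1 := graph_le_of_mem_closure hγ hloc hb hmem
  have h2 := graph_eq_of_mem_frontier hF hγ hloc hxb hxF
  have h3 : inner ℝ n (x - t • n) = inner ℝ n x - t := by
    rw [inner_sub_right, inner_smul_right, real_inner_self_eq_norm_sq, hn]; ring
  have h4 : x - t • n - (inner ℝ n x - t) • n = x - inner ℝ n x • n := by module
  rw [h3, h4, h2] at h1
  linarith

theorem enorm_rpow_le_line {n : E} (hn : ‖n‖ = 1) {p : ℝ} (hp : 1 ≤ p) {u : E → ℝ}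
    (hu : ContDiff ℝ 1 u) {W R : Set E} (hW : IsOpen W) {y : E} {a δ : ℝ} (hδ : 0 < δ)
    (hδ1 : δ ≤ 1) (hyW : y + a • n ∈ W)
    (hR : ∀ t ∈ Ioo 0 δ, y + (a - t) • n ∈ R) :
    (∃ t : ℝ, y + t • n ∈ frontier W ∧
      ‖u (y + a • n)‖ₑ ^ p ≤ 2 ^ (p - 1) * ‖u (y + t • n)‖ₑ ^ p +
        2 ^ (p - 1) * (ENNReal.ofReal δ)⁻¹ *
          ∫⁻ s : ℝ, (W ∩ R).indicator (fun x => ‖u x‖ₑ ^ p + ‖fderiv ℝ u x‖ₑ ^ p) (y + s • n)) ∨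
    ‖u (y + a • n)‖ₑ ^ p ≤ 2 ^ (p - 1) * (ENNReal.ofReal δ)⁻¹ *
      ∫⁻ s : ℝ, (W ∩ R).indicator (fun x => ‖u x‖ₑ ^ p + ‖fderiv ℝ u x‖ₑ ^ p) (y + s • n) := by
  have hline : ContDiff ℝ 1 fun t : ℝ => y + (a - t) • n := by fun_prop
  have hO : IsOpen ((fun t : ℝ => y + (a - t) • n) ⁻¹' W) := hW.preimage hline.continuous
  set φ : ℝ → ℝ := fun t => u (y + (a - t) • n) with hφdef
  have hφ : ContDiff ℝ 1 φ := hu.comp hline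
  have hderiv : ∀ t, ‖deriv φ t‖ₑ ≤ ‖fderiv ℝ u (y + (a - t) • n)‖ₑ := by
    intro t
    have hl : HasDerivAt (fun t : ℝ => y + (a - t) • n) (-n) t := by
      have := (((hasDerivAt_id t).const_sub a).smul_const n).const_add y
      simpa using this
    have h1 : HasDerivAt φ (fderiv ℝ u (y + (a - t) • n) (-n)) t :=
      ((hu.differentiable one_ne_zero) _).hasFDerivAt.comp_hasDerivAt t hl
    rw [h1.deriv, ← ofReal_norm, ← ofReal_norm]
    refine ENNReal.ofReal_le_ofReal ?_
    simpa [hn] using (fderiv ℝ u (y + (a - t) • n)).le_opNorm (-n)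
  set I := ∫⁻ s : ℝ, (W ∩ R).indicator (fun x => ‖u x‖ₑ ^ p + ‖fderiv ℝ u x‖ₑ ^ p) (y + s • n)
    with hI
  have hint : ∫⁻ s in Ioo 0 δ ∩ ((fun t : ℝ => y + (a - t) • n) ⁻¹' W),
      (‖φ s‖ₑ ^ p + ‖deriv φ s‖ₑ ^ p) ≤ I := by
    -- The substitution `s ↦ a - s` turns height on the line into distance travelled from the
    -- starting point.
    rw [hI, ← lintegral_sub_left_eq_self (μ := volume) _ a,
      ← lintegral_indicator (measurableSet_Ioo.inter hO.measurableSet)]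
    refine lintegral_mono fun s => ?_
    by_cases hs : s ∈ Ioo 0 δ ∩ ((fun t : ℝ => y + (a - t) • n) ⁻¹' W)
    · have hs' : y + (a - s) • n ∈ W ∩ R := ⟨hs.2, hR s hs.1⟩
      rw [indicator_of_mem hs, indicator_of_mem hs']
      gcongr
      exact hderiv s
    · rw [indicator_of_notMem hs]
      exact zero_le
  have h0 : (0 : ℝ) ∈ (fun t : ℝ => y + (a - t) • n) ⁻¹' W := by simpa using hyW
  have hφ0 : φ 0 = u (y + a • n) := by simp [hφdef]
  rcases enorm_rpow_le_of_isOpen hφ hp hO h0 hδ hδ1 with ⟨t, _, ht, hle⟩ | hle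
  · left
    refine ⟨a - t, hline.continuous.frontier_preimage_subset _ ht, ?_⟩
    rw [← hφ0]
    exact hle.trans (by gcongr)
  · right
    rw [← hφ0]
    exact hle.trans (by gcongr)

end Graph

/-! ### Trace inequality on the boundary of one hole -/

/-- The outer collar of width `δ` of a set. -/
def outerCollar {E : Type*} [PseudoMetricSpace E] (δ : ℝ) (F : Set E) : Set E :=
  Metric.thickening δ (closure F) \ closure F

theorem isOpen_outerCollar {E : Type*} [PseudoMetricSpace E] (δ : ℝ) (F : Set E) :
    IsOpen (outerCollar δ F) :=
  Metric.isOpen_thickening.sdiff isClosed_closure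

section Collar

variable {E : Type*} [NormedAddCommGroup E] [InnerProductSpace ℝ E]
  [FiniteDimensional ℝ E] [MeasurableSpace E] [BorelSpace E] {d : ℕ}
  [Fact (Module.finrank ℝ E = d + 1)]

/-- The graph map is Lipschitz on a compact ball, so the surface integral is controlled by one over
the hyperplane, where each vertical line obeys `enorm_rpow_le_line`. Exit points project back to the
base points of their lines, and the projection is 1-Lipschitz, so their contribution is at most the
integral over `∂W`, however irregular `∂W` is. -/
theorem exists_lintegral_graph_le {F : Set E} (hF : IsOpen F) {x₀ n : E} (hn : ‖n‖ = 1) {r : ℝ}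
    (hr : 0 < r) {γ : E → ℝ} (hγ : ContDiff ℝ 1 γ)
    (hloc : F ∩ Metric.ball x₀ r =
      {x | γ (x - inner ℝ n x • n) < inner ℝ n x} ∩ Metric.ball x₀ r)
    {δ₀ : ℝ} (hδ₀ : 0 < δ₀) {p : ℝ} (hp : 1 ≤ p) :
    ∃ C : NNReal, ∀ W : Set E, IsOpen W → closure F ⊆ W → ∀ u : E → ℝ, ContDiff ℝ 1 u →
      ∫⁻ x in frontier F ∩ Metric.closedBall x₀ (r / 2), ‖u x‖ₑ ^ p
          ∂(Measure.euclideanHausdorffMeasure d) ≤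
        C * ((∫⁻ x in W ∩ outerCollar δ₀ F, (‖u x‖ₑ ^ p + ‖fderiv ℝ u x‖ₑ ^ p)) +
          ∫⁻ x in frontier W, ‖u x‖ₑ ^ p ∂(Measure.euclideanHausdorffMeasure d)) := by
  set π := (ℝ ∙ n)ᗮ.orthogonalProjectionOnto with hπ
  set Φ : (ℝ ∙ n)ᗮ → E := fun y => (y : E) + γ y • n with hΦ
  have hΦc : ContDiff ℝ 1 Φ := by
    have h1 : ContDiff ℝ 1 fun y : (ℝ ∙ n)ᗮ => (y : E) := (ℝ ∙ n)ᗮ.subtypeL.contDiff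
    exact h1.add ((hγ.comp h1).smul contDiff_const)
  have : ProperSpace (ℝ ∙ n)ᗮ := FiniteDimensional.proper ℝ _
  obtain ⟨L, hL⟩ := (hΦc.locallyLipschitz.locallyLipschitzOn
    (s := Metric.closedBall (π x₀) (r / 2))).exists_lipschitzOnWith_of_compact
    (isCompact_closedBall _ _)
  obtain ⟨c, hc⟩ := exists_lintegral_slices_eq (d := d) hn
  set A := frontier F ∩ Metric.closedBall x₀ (r / 2) with hA
  have hAm : MeasurableSet A := (isClosed_frontier.inter Metric.isClosed_closedBall).measurableSet
  set S := Metric.closedBall (π x₀) (r / 2) ∩ Φ ⁻¹' A with hS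
  have hSm : MeasurableSet S :=
    Metric.isClosed_closedBall.measurableSet.inter (hΦc.continuous.measurable hAm)
  -- `r / 2` keeps segments in the chart, `δ₀` keeps them in the collar, and `1` is required by the
  -- one-dimensional estimate.
  set δ := min (r / 2) (min δ₀ 1) with hδ
  have hδpos : 0 < δ := lt_min (by linarith) (lt_min hδ₀ one_pos)
  set K : ℝ≥0∞ := 2 ^ (p - 1) * (ENNReal.ofReal δ)⁻¹ with hK
  set B : ℝ≥0∞ := 2 ^ (p - 1) with hB
  have hBtop : B ≠ ⊤ := ENNReal.rpow_ne_top_of_nonneg (by linarith) (by simp)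
  have hKtop : K ≠ ⊤ := ENNReal.mul_ne_top hBtop (by simpa using hδpos)
  set M : ℝ≥0∞ := (L : ℝ≥0∞) ^ d * (B + K * c)
  have hMtop : M ≠ ⊤ := by finiteness
  refine ⟨M.toNNReal, fun W hW hFW u hu => ?_⟩
  rw [ENNReal.coe_toNNReal hMtop]
  have hum : Measurable fun x => ‖u x‖ₑ ^ p := hu.continuous.measurable.enorm.pow_const p
  have hdm : Measurable fun x => ‖fderiv ℝ u x‖ₑ ^ p :=
    (hu.continuous_fderiv one_ne_zero).enorm.measurable.pow_const p
  set f := (W ∩ outerCollar δ₀ F).indicator fun x => ‖u x‖ₑ ^ p + ‖fderiv ℝ u x‖ₑ ^ p with hf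
  have hWm : MeasurableSet (W ∩ outerCollar δ₀ F) :=
    (hW.inter (isOpen_outerCollar _ _)).measurableSet
  have hfm : Measurable f := (hum.add hdm).indicator hWm
  set G : (ℝ ∙ n)ᗮ → ℝ≥0∞ := fun y => K * ∫⁻ s : ℝ, f ((y : E) + s • n) with hG
  have hGm : Measurable G := by
    refine Measurable.const_mul ?_ K
    refine Measurable.lintegral_prod_right' (f := fun z : (ℝ ∙ n)ᗮ × ℝ => f ((z.1 : E) + z.2 • n))
      (hfm.comp ?_)
    fun_prop
  have hΦA : ∀ x ∈ A, Φ (π x) = x := by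
    intro x hx
    have hxb : x ∈ Metric.ball x₀ r := Metric.closedBall_subset_ball (by linarith) hx.2
    simp only [hΦ, hπ, coe_orthogonalProjectionOnto_orthogonal_span_singleton hn,
      graph_eq_of_mem_frontier hF hγ.continuous hloc hxb hx.1]
    module
  have hstep1 : ∫⁻ x in A, ‖u x‖ₑ ^ p ∂(Measure.euclideanHausdorffMeasure d) ≤
      (L : ℝ≥0∞) ^ d * ∫⁻ y in S, ‖u (Φ y)‖ₑ ^ p ∂(Measure.euclideanHausdorffMeasure d) := by
    rw [← lintegral_indicator hAm]
    refine (hL.mono inter_subset_left).lintegral_euclideanHausdorffMeasure_le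
      hΦc.continuous.measurable hSm d (hum.comp hΦc.continuous.measurable) fun x hx => ?_
    have hxA : x ∈ A := mem_of_indicator_ne_zero hx
    refine ⟨π x, ⟨?_, ?_⟩, hΦA x hxA, ?_⟩
    · have := (ℝ ∙ n)ᗮ.lipschitzWith_orthogonalProjectionOnto.dist_le_mul x x₀
      rw [NNReal.coe_one, one_mul] at this
      exact this.trans hxA.2
    · rw [mem_preimage, hΦA x hxA]; exact hxA
    · rw [indicator_of_mem hxA, hΦA x hxA]
  have hpt : ∀ y ∈ S, (∃ t : ℝ, (y : E) + t • n ∈ frontier W ∧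
      ‖u (Φ y)‖ₑ ^ p ≤ B * ‖u ((y : E) + t • n)‖ₑ ^ p + G y) ∨ ‖u (Φ y)‖ₑ ^ p ≤ G y := by
    intro y hy
    have hfr : Φ y ∈ frontier F := hy.2.1
    refine enorm_rpow_le_line hn hp hu hW hδpos ((min_le_right _ _).trans (min_le_right _ _))
      (hFW (frontier_subset_closure hfr)) fun t ht => ?_
    have ht1 : t < r / 2 := ht.2.trans_le (min_le_left _ _)
    have ht2 : t < δ₀ := ht.2.trans_le ((min_le_right _ _).trans (min_le_left _ _))
    have heq : (y : E) + (γ y - t) • n = Φ y - t • n := by simp only [hΦ]; module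
    rw [heq]
    refine ⟨Metric.mem_thickening_iff.2 ⟨Φ y, frontier_subset_closure hfr, ?_⟩,
      sub_smul_notMem_closure hF hn hγ.continuous hloc hy.2.2 hfr ht.1 ht1⟩
    rw [dist_eq_norm]
    simpa [norm_smul, hn, abs_of_pos ht.1] using ht2
  -- `a y` is the exit contribution of the line over `y`, and zero where none is needed. It comes
  -- from a choice and need not be measurable.
  have hex : ∀ y : (ℝ ∙ n)ᗮ, ∃ a : ℝ≥0∞, (a ≠ 0 → ∃ t : ℝ, (y : E) + t • n ∈ frontier W ∧
      a ≤ ‖u ((y : E) + t • n)‖ₑ ^ p) ∧ (y ∈ S → ‖u (Φ y)‖ₑ ^ p ≤ B * a + G y) := by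
    intro y
    by_cases hy : y ∈ S
    · rcases hpt y hy with ⟨t, ht, hle⟩ | hle
      · exact ⟨‖u ((y : E) + t • n)‖ₑ ^ p, fun _ => ⟨t, ht, le_rfl⟩, fun _ => hle⟩
      · exact ⟨0, fun h => absurd rfl h, fun _ => by simpa using hle⟩
    · exact ⟨0, fun h => absurd rfl h, fun h => absurd h hy⟩
  choose a ha1 ha2 using hex
  have hstep2 : ∫⁻ y, a y ∂(Measure.euclideanHausdorffMeasure d) ≤
      ∫⁻ x in frontier W, ‖u x‖ₑ ^ p ∂(Measure.euclideanHausdorffMeasure d) := by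
    have := ((ℝ ∙ n)ᗮ.lipschitzWith_orthogonalProjectionOnto.lipschitzOnWith
      (s := frontier W)).lintegral_euclideanHausdorffMeasure_le (a := a) π.continuous.measurable
      isClosed_frontier.measurableSet d hum fun y hy => by
        obtain ⟨t, ht, hle⟩ := ha1 y hy
        exact ⟨(y : E) + t • n, ht, orthogonalProjectionOnto_add_smul hn y t, hle⟩
    simpa using this
  refine hstep1.trans ?_
  rw [mul_assoc]
  gcongr
  calc ∫⁻ y in S, ‖u (Φ y)‖ₑ ^ p ∂(Measure.euclideanHausdorffMeasure d)
      ≤ ∫⁻ y in S, (B * a y + G y) ∂(Measure.euclideanHausdorffMeasure d) :=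
        setLIntegral_mono' hSm fun y hy => ha2 y hy
    _ ≤ ∫⁻ y, (B * a y + G y) ∂(Measure.euclideanHausdorffMeasure d) :=
        setLIntegral_le_lintegral _ _
    _ = B * (∫⁻ y, a y ∂(Measure.euclideanHausdorffMeasure d)) + K * (c * ∫⁻ x, f x) := by
        -- Additivity uses the measurability of `G` alone, and the constants are finite, so nothing
        -- is asked of `a`.
        rw [lintegral_add_right _ hGm, lintegral_const_mul' _ _ hBtop,
          lintegral_const_mul' _ _ hKtop, hc f hfm]
    _ ≤ _ := by
        rw [lintegral_indicator hWm, ← mul_assoc, add_comm, mul_add]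
        gcongr
        · exact le_add_self
        · exact le_self_add

theorem exists_lintegral_frontier_le {F : Set E} (hF : IsOpen F)
    (hFc : IsCompact (frontier F))
    (hbdry : ∀ x₀ ∈ frontier F, ∃ r : ℝ, 0 < r ∧ ∃ (n : E) (γ : E → ℝ), ‖n‖ = 1 ∧
      ContDiff ℝ 1 γ ∧ F ∩ Metric.ball x₀ r =
        {x | γ (x - inner ℝ n x • n) < inner ℝ n x} ∩ Metric.ball x₀ r)
    {δ₀ : ℝ} (hδ₀ : 0 < δ₀) {p : ℝ} (hp : 1 ≤ p) :
    ∃ C : NNReal, ∀ W : Set E, IsOpen W → closure F ⊆ W → ∀ u : E → ℝ, ContDiff ℝ 1 u →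
      ∫⁻ x in frontier F, ‖u x‖ₑ ^ p ∂(Measure.euclideanHausdorffMeasure d) ≤
        C * ((∫⁻ x in W ∩ outerCollar δ₀ F, (‖u x‖ₑ ^ p + ‖fderiv ℝ u x‖ₑ ^ p)) +
          ∫⁻ x in frontier W, ‖u x‖ₑ ^ p ∂(Measure.euclideanHausdorffMeasure d)) := by
  -- One copy of `frontier F` becomes the variable set of the compactness induction; constants add
  -- under unions.
  suffices ∃ C : NNReal, ∀ W : Set E, IsOpen W → closure F ⊆ W → ∀ u : E → ℝ, ContDiff ℝ 1 u →
      ∫⁻ x in frontier F ∩ frontier F, ‖u x‖ₑ ^ p ∂(Measure.euclideanHausdorffMeasure d) ≤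
        C * ((∫⁻ x in W ∩ outerCollar δ₀ F, (‖u x‖ₑ ^ p + ‖fderiv ℝ u x‖ₑ ^ p)) +
          ∫⁻ x in frontier W, ‖u x‖ₑ ^ p ∂(Measure.euclideanHausdorffMeasure d)) by
    simpa only [inter_self] using this
  refine hFc.induction_on (p := fun T => ∃ C : NNReal, ∀ W : Set E, IsOpen W → closure F ⊆ W →
    ∀ u : E → ℝ, ContDiff ℝ 1 u →
      ∫⁻ x in frontier F ∩ T, ‖u x‖ₑ ^ p ∂(Measure.euclideanHausdorffMeasure d) ≤
        C * ((∫⁻ x in W ∩ outerCollar δ₀ F, (‖u x‖ₑ ^ p + ‖fderiv ℝ u x‖ₑ ^ p)) +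
          ∫⁻ x in frontier W, ‖u x‖ₑ ^ p ∂(Measure.euclideanHausdorffMeasure d))) ?_ ?_ ?_ ?_
  · exact ⟨0, fun W _ _ u _ => by simp⟩
  · rintro s t hst ⟨C, hC⟩
    exact ⟨C, fun W hW hFW u hu =>
      (lintegral_mono_set (inter_subset_inter_right _ hst)).trans (hC W hW hFW u hu)⟩
  · rintro s t ⟨C, hC⟩ ⟨C', hC'⟩
    refine ⟨C + C', fun W hW hFW u hu => ?_⟩
    rw [inter_union_distrib_left, ENNReal.coe_add, add_mul]
    exact (lintegral_union_le _ _ _).trans (add_le_add (hC W hW hFW u hu) (hC' W hW hFW u hu))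
  · intro x₀ hx₀
    obtain ⟨r, hr, n, γ, hn, hγ, hloc⟩ := hbdry x₀ hx₀
    exact ⟨Metric.closedBall x₀ (r / 2),
      mem_nhdsWithin_of_mem_nhds (Metric.closedBall_mem_nhds _ (by linarith)),
      exists_lintegral_graph_le hF hn hr hγ hloc hδ₀ hp⟩

end Collar

/-! ### Scaling -/

theorem lintegral_image_euclideanHausdorffMeasure_le {X Y : Type*} [EMetricSpace X]
    [MeasurableSpace X] [BorelSpace X] [EMetricSpace Y] [MeasurableSpace Y] [BorelSpace Y]
    (e : X ≃ₜ Y) {K : NNReal} (he : LipschitzWith K e) {s : Set X} (hs : MeasurableSet s) (d : ℕ)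
    {g : Y → ℝ≥0∞} (hg : Measurable g) :
    ∫⁻ y in e '' s, g y ∂(Measure.euclideanHausdorffMeasure d) ≤
      (K : ℝ≥0∞) ^ d * ∫⁻ x in s, g (e x) ∂(Measure.euclideanHausdorffMeasure d) := by
  rw [← lintegral_indicator (e.measurableEmbedding.measurableSet_image.2 hs)]
  refine he.lipschitzOnWith.lintegral_euclideanHausdorffMeasure_le e.measurable hs d
    (hg.comp e.measurable) fun y hy => ?_
  obtain ⟨x, hx, rfl⟩ := mem_of_indicator_ne_zero hy
  exact ⟨x, hx, rfl, by rw [indicator_of_mem (mem_image_of_mem e hx)]⟩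

section Dilation

variable {E : Type*} [NormedAddCommGroup E]

/-- The dilation `y ↦ b + ε y`. -/
noncomputable def dilation [NormedSpace ℝ E] (b : E) {ε : ℝ} (hε : 0 < ε) : E ≃ₜ E :=
  (Homeomorph.smulOfNeZero ε hε.ne').trans (Homeomorph.addLeft b)

theorem dilation_apply [NormedSpace ℝ E] (b : E) {ε : ℝ} (hε : 0 < ε) (y : E) :
    dilation b hε y = b + ε • y := rfl

theorem dist_dilation [NormedSpace ℝ E] (b : E) {ε : ℝ} (hε : 0 < ε) (x y : E) :
    dist (dilation b hε x) (dilation b hε y) = ε * dist x y := by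
  rw [dilation_apply, dilation_apply, dist_add_left, dist_smul₀, Real.norm_of_nonneg hε.le]

theorem lipschitzWith_dilation [NormedSpace ℝ E] (b : E) {ε : ℝ} (hε : 0 < ε) :
    LipschitzWith ε.toNNReal (dilation b hε) :=
  LipschitzWith.of_dist_le_mul fun x y => by
    rw [dist_dilation, Real.coe_toNNReal _ hε.le]

theorem lipschitzWith_dilation_symm [NormedSpace ℝ E] (b : E) {ε : ℝ} (hε : 0 < ε) :
    LipschitzWith ε⁻¹.toNNReal (dilation b hε).symm :=
  LipschitzWith.of_dist_le_mul fun x y => by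
    have := dist_dilation b hε ((dilation b hε).symm x) ((dilation b hε).symm y)
    rw [Homeomorph.apply_symm_apply, Homeomorph.apply_symm_apply] at this
    rw [this, Real.coe_toNNReal _ (inv_nonneg.2 hε.le), inv_mul_cancel_left₀ hε.ne']

theorem enorm_fderiv_comp_dilation_le [NormedSpace ℝ E] (b : E) {ε : ℝ} (hε : 0 < ε) {u : E → ℝ}
    (hu : ContDiff ℝ 1 u) (y : E) :
    ‖fderiv ℝ (fun y => u (dilation b hε y)) y‖ₑ ≤
      ENNReal.ofReal ε * ‖fderiv ℝ u (dilation b hε y)‖ₑ := by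
  have h1 : HasFDerivAt (dilation b hε) (ε • ContinuousLinearMap.id ℝ E) y :=
    ((hasFDerivAt_id y).const_smul ε).const_add b
  have h2 := ((hu.differentiable one_ne_zero) (dilation b hε y)).hasFDerivAt.comp y h1
  have h3 : fderiv ℝ (fun y => u (dilation b hε y)) y = ε • fderiv ℝ u (dilation b hε y) := by
    refine h2.fderiv.trans ?_
    ext; simp
  rw [h3, enorm_smul, Real.enorm_of_nonneg hε.le]

variable [InnerProductSpace ℝ E]
  [FiniteDimensional ℝ E] [MeasurableSpace E] [BorelSpace E] {d : ℕ}
  [Fact (Module.finrank ℝ E = d + 1)]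

/-- Surface scales by `ε^d`, volume by `ε^(d+1)`, and the gradient by `ε`; the extra factor `ε`
balances the first two. The unscaled inequality is applied with `W` the preimage of `Ω`, which is
why it must be uniform in `W`. -/
theorem lintegral_frontier_dilation_le {F R : Set E} (hR : MeasurableSet R) {p : ℝ} (hp : 1 ≤ p)
    {C : ℝ≥0∞}
    (hC : ∀ W : Set E, IsOpen W → closure F ⊆ W → ∀ u : E → ℝ, ContDiff ℝ 1 u →
      ∫⁻ x in frontier F, ‖u x‖ₑ ^ p ∂(Measure.euclideanHausdorffMeasure d) ≤
        C * ((∫⁻ x in W ∩ R, (‖u x‖ₑ ^ p + ‖fderiv ℝ u x‖ₑ ^ p)) +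
          ∫⁻ x in frontier W, ‖u x‖ₑ ^ p ∂(Measure.euclideanHausdorffMeasure d)))
    (b : E) {ε : ℝ} (hε : 0 < ε) {Ω : Set E} (hΩ : IsOpen Ω)
    (hFΩ : dilation b hε '' closure F ⊆ Ω) {u : E → ℝ} (hu : ContDiff ℝ 1 u) :
    ENNReal.ofReal ε * ∫⁻ x in dilation b hε '' frontier F, ‖u x‖ₑ ^ p
        ∂(Measure.euclideanHausdorffMeasure d) ≤
      C * ((∫⁻ x in Ω ∩ dilation b hε '' R,
          (‖u x‖ₑ ^ p + ENNReal.ofReal ε ^ p * ‖fderiv ℝ u x‖ₑ ^ p)) +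
        ENNReal.ofReal ε *
          ∫⁻ x in frontier Ω, ‖u x‖ₑ ^ p ∂(Measure.euclideanHausdorffMeasure d)) := by
  set A := dilation b hε with hA
  -- With volume as a Hausdorff measure, one Lipschitz comparison serves both dimensions.
  have hvol : (volume : Measure E) = Measure.euclideanHausdorffMeasure (d + 1) := by
    rw [← InnerProductSpace.euclideanHausdorffMeasure_eq_volume,
      Fact.out (p := Module.finrank ℝ E = d + 1)]
  have hum : Measurable fun x => ‖u x‖ₑ ^ p := hu.continuous.measurable.enorm.pow_const p
  have hdm : Measurable fun x => ‖fderiv ℝ u x‖ₑ ^ p :=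
    (hu.continuous_fderiv one_ne_zero).enorm.measurable.pow_const p
  have hAu : ContDiff ℝ 1 fun y => u (A y) := by
    simp only [hA, dilation_apply]
    fun_prop
  set e := ENNReal.ofReal ε with he
  have he0 : e ≠ 0 := by simpa [he] using hε
  have hetop : e ≠ ⊤ := ENNReal.ofReal_ne_top
  have heinv : ((ε⁻¹.toNNReal : NNReal) : ℝ≥0∞) = e⁻¹ := ENNReal.ofReal_inv_of_pos hε
  have h1 : ∫⁻ x in A '' frontier F, ‖u x‖ₑ ^ p ∂(Measure.euclideanHausdorffMeasure d) ≤
      e ^ d * ∫⁻ y in frontier F, ‖u (A y)‖ₑ ^ p ∂(Measure.euclideanHausdorffMeasure d) :=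
    lintegral_image_euclideanHausdorffMeasure_le A (lipschitzWith_dilation b hε)
      isClosed_frontier.measurableSet d hum
  have h2 := hC (A ⁻¹' Ω) (hΩ.preimage A.continuous) (image_subset_iff.1 hFΩ) _ hAu
  have h3 : ∫⁻ y in A ⁻¹' Ω ∩ R, (‖u (A y)‖ₑ ^ p + ‖fderiv ℝ (fun y => u (A y)) y‖ₑ ^ p) ≤
      e⁻¹ ^ (d + 1) * ∫⁻ x in Ω ∩ A '' R, (‖u x‖ₑ ^ p + e ^ p * ‖fderiv ℝ u x‖ₑ ^ p) := by
    have hset : A ⁻¹' Ω ∩ R = A.symm '' (Ω ∩ A '' R) := by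
      rw [image_inter A.symm.injective, Homeomorph.image_symm, preimage_image_eq _ A.injective]
    have hm : MeasurableSet (Ω ∩ A '' R) :=
      hΩ.measurableSet.inter (A.measurableEmbedding.measurableSet_image.2 hR)
    have hg : Measurable fun y => ‖u (A y)‖ₑ ^ p + e ^ p * ‖fderiv ℝ u (A y)‖ₑ ^ p :=
      (hum.comp A.measurable).add ((hdm.comp A.measurable).const_mul _)
    calc ∫⁻ y in A ⁻¹' Ω ∩ R, (‖u (A y)‖ₑ ^ p + ‖fderiv ℝ (fun y => u (A y)) y‖ₑ ^ p)
        ≤ ∫⁻ y in A ⁻¹' Ω ∩ R, (‖u (A y)‖ₑ ^ p + e ^ p * ‖fderiv ℝ u (A y)‖ₑ ^ p) := by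
          refine lintegral_mono fun y => ?_
          rw [← ENNReal.mul_rpow_of_nonneg _ _ (by linarith)]
          gcongr
          exact enorm_fderiv_comp_dilation_le b hε hu y
      _ ≤ _ := by
          rw [hset, hvol]
          have := lintegral_image_euclideanHausdorffMeasure_le A.symm
            (lipschitzWith_dilation_symm b hε) hm (d + 1) hg
          simpa only [heinv, Homeomorph.apply_symm_apply] using this
  have h4 : ∫⁻ y in frontier (A ⁻¹' Ω), ‖u (A y)‖ₑ ^ p ∂(Measure.euclideanHausdorffMeasure d) ≤
      e⁻¹ ^ d * ∫⁻ x in frontier Ω, ‖u x‖ₑ ^ p ∂(Measure.euclideanHausdorffMeasure d) := by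
    have := lintegral_image_euclideanHausdorffMeasure_le A.symm
      (lipschitzWith_dilation_symm b hε) isClosed_frontier.measurableSet (s := frontier Ω) d
      (hum.comp A.measurable)
    rw [Homeomorph.image_symm, A.preimage_frontier] at this
    simpa only [heinv, Function.comp_apply, Homeomorph.apply_symm_apply] using this
  have hcancel : ∀ m : ℕ, e ^ m * e⁻¹ ^ m = 1 := fun m => by
    rw [← mul_pow, ENNReal.mul_inv_cancel he0 hetop, one_pow]
  set I₁ := ∫⁻ x in Ω ∩ A '' R, (‖u x‖ₑ ^ p + e ^ p * ‖fderiv ℝ u x‖ₑ ^ p)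
  set I₂ := ∫⁻ x in frontier Ω, ‖u x‖ₑ ^ p ∂(Measure.euclideanHausdorffMeasure d)
  calc e * ∫⁻ x in A '' frontier F, ‖u x‖ₑ ^ p ∂(Measure.euclideanHausdorffMeasure d)
      ≤ e * (e ^ d * (C * (e⁻¹ ^ (d + 1) * I₁ + e⁻¹ ^ d * I₂))) := by
        gcongr
        exact h1.trans (by gcongr; exact h2.trans (by gcongr))
    _ = C * ((e ^ (d + 1) * e⁻¹ ^ (d + 1)) * I₁ + e * ((e ^ d * e⁻¹ ^ d) * I₂)) := by ring
    _ = C * (I₁ + e * I₂) := by rw [hcancel, hcancel, one_mul, one_mul]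

end Dilation

/-! ### Lattice translates and their separation -/

section Cells

variable {N : ℕ}

theorem isCompact_of_subset_unitCell {S : Set (EuclideanSpace ℝ (Fin N))} (hS : IsClosed S)
    (hSY : S ⊆ unitCell N) : IsCompact S := by
  refine ((isCompact_Icc (a := (0 : Fin N → ℝ)) (b := 1)).image
    (PiLp.continuous_toLp 2 _)).of_isClosed_subset hS fun y hy => ?_
  exact ⟨WithLp.ofLp y, ⟨fun i => (hSY hy i).1, fun i => (hSY hy i).2⟩, rfl⟩

theorem latticeVec_sub (k l : Fin N → ℤ) :
    (latticeVec (k - l) : EuclideanSpace ℝ (Fin N)) = latticeVec k - latticeVec l := by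
  ext i; simp [latticeVec]

theorem one_le_dist_latticeVec {k l : Fin N → ℤ} (h : k ≠ l) :
    1 ≤ dist (latticeVec k : EuclideanSpace ℝ (Fin N)) (latticeVec l) := by
  obtain ⟨i, hi⟩ := Function.ne_iff.1 h
  rw [dist_eq_norm, ← latticeVec_sub]
  refine le_trans ?_ (PiLp.norm_apply_le _ i)
  have : (1 : ℤ) ≤ |k i - l i| := Int.one_le_abs (sub_ne_zero.2 hi)
  simp only [latticeVec, Pi.sub_apply, Real.norm_eq_abs]
  exact_mod_cast this

theorem isClosed_image_latticeVec (S : Set (Fin N → ℤ)) :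
    IsClosed ((latticeVec : (Fin N → ℤ) → EuclideanSpace ℝ (Fin N)) '' S) := by
  refine Metric.isClosed_of_pairwise_le_dist one_pos ?_
  rintro _ ⟨k, _, rfl⟩ _ ⟨l, _, rfl⟩ hne
  exact one_le_dist_latticeVec fun h => hne (h ▸ rfl)

theorem scaledCopy_eq_image_dilation {ε : ℝ} (hε : 0 < ε) (k : Fin N → ℤ)
    (S : Set (EuclideanSpace ℝ (Fin N))) :
    scaledCopy ε k S = dilation (ε • latticeVec k) hε '' S := rfl

theorem finite_setOf_scaledCopy_inter_nonempty {Ω : Set (EuclideanSpace ℝ (Fin N))}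
    (hΩ : Bornology.IsBounded Ω) {ε : ℝ} (hε : 0 < ε) :
    {k : Fin N → ℤ | (scaledCopy ε k (unitCell N) ∩ Ω).Nonempty}.Finite := by
  obtain ⟨R, hR⟩ := hΩ.exists_norm_le
  obtain ⟨M, hM⟩ := exists_nat_ge (R / ε + 1)
  refine (finite_Icc (fun _ => -(M : ℤ)) (fun _ => (M : ℤ))).subset ?_
  rintro k ⟨x, ⟨y, hy, rfl⟩, hx⟩
  have key : ∀ i, |(k i : ℝ)| ≤ M := by
    intro i
    have h1 : |ε * (k i : ℝ) + ε * y i| ≤ R := by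
      have := (PiLp.norm_apply_le (ε • latticeVec k + ε • y) i).trans (hR _ hx)
      simpa [latticeVec] using this
    rw [← mul_add, abs_mul, abs_of_pos hε, ← le_div_iff₀' hε] at h1
    have h2 : |y i| ≤ 1 := abs_le.2 ⟨by linarith [(hy i).1], (hy i).2⟩
    have h3 : |(k i : ℝ)| ≤ |(k i : ℝ) + y i| + |y i| := by
      simpa using abs_sub ((k i : ℝ) + y i) (y i)
    linarith
  refine ⟨fun i => ?_, fun i => ?_⟩
  · exact_mod_cast (abs_le.1 (key i)).1
  · exact_mod_cast (abs_le.1 (key i)).2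

open scoped Pointwise in
-- The union of all nonzero lattice translates of `G` is closed, as a closed set plus a compact one,
-- so it lies at positive distance from `G`. Translation and scaling make the same `δ` work for all
-- pairs and all `ε`.
theorem exists_disjoint_scaledCopy_thickening {G : Set (EuclideanSpace ℝ (Fin N))}
    (hG : IsCompact G) (hdisj : ∀ k : Fin N → ℤ, k ≠ 0 → Disjoint G (scaledCopy 1 k G)) :
    ∃ δ : ℝ, 0 < δ ∧ ∀ ε : ℝ, 0 < ε → ∀ k l : Fin N → ℤ, k ≠ l →
      Disjoint (scaledCopy ε k (Metric.thickening δ G))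
        (scaledCopy ε l (Metric.thickening δ G)) := by
  set U : Set (EuclideanSpace ℝ (Fin N)) :=
    (latticeVec : (Fin N → ℤ) → EuclideanSpace ℝ (Fin N)) '' {k | k ≠ 0} + G
  have hU : IsClosed U := (isClosed_image_latticeVec _).add_right_of_isCompact hG
  have hGU : Disjoint G U := by
    rw [disjoint_left]
    rintro x hx ⟨_, ⟨k, hk, rfl⟩, g, hg, rfl⟩
    exact disjoint_left.1 (hdisj k hk) hx ⟨g, hg, by simp⟩
  obtain ⟨δ, hδ, hd⟩ := hGU.exists_thickenings hG hU
  refine ⟨δ, hδ, fun ε hε k l hkl => disjoint_left.2 ?_⟩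
  rintro _ ⟨y, hy, rfl⟩ ⟨z, hz, hzy⟩
  have hzy' : y = latticeVec (l - k) + z := by
    have h1 : ε • (latticeVec l + z) = ε • (latticeVec k + y) := by
      simpa only [smul_add] using hzy
    have h2 := smul_right_injective (EuclideanSpace ℝ (Fin N)) hε.ne' h1
    rw [latticeVec_sub, sub_add_eq_add_sub, h2, add_sub_cancel_left]
  obtain ⟨g, hg, hzg⟩ := Metric.mem_thickening_iff.1 hz
  refine disjoint_left.1 hd hy (Metric.mem_thickening_iff.2
    ⟨latticeVec (l - k) + g, ⟨_, ⟨l - k, sub_ne_zero.2 hkl.symm, rfl⟩, g, hg, rfl⟩, ?_⟩)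
  rw [hzy', dist_add_left]
  exact hzg

end Cells

/-! ### Topology of the perforated domain -/

section Perforated

variable {N : ℕ} {Ω F : Set (EuclideanSpace ℝ (Fin N))} {ε : ℝ}

/-- The indices of the holes. -/
def holeIndices (Ω F : Set (EuclideanSpace ℝ (Fin N))) (ε : ℝ) : Set (Fin N → ℤ) :=
  {k | (scaledCopy ε k (unitCell N) ∩ Ω).Nonempty ∧ closure (scaledCopy ε k F) ⊆ Ω}

theorem finite_holeIndices (hΩ : Bornology.IsBounded Ω) (hε : 0 < ε) :
    (holeIndices Ω F ε).Finite :=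
  (finite_setOf_scaledCopy_inter_nonempty hΩ hε).subset fun _ hk => hk.1

theorem closure_scaledCopy (hε : 0 < ε) (k : Fin N → ℤ) (S : Set (EuclideanSpace ℝ (Fin N))) :
    closure (scaledCopy ε k S) = scaledCopy ε k (closure S) := by
  rw [scaledCopy_eq_image_dilation hε, scaledCopy_eq_image_dilation hε, Homeomorph.image_closure]

theorem closure_holes (hΩ : Bornology.IsBounded Ω) (hε : 0 < ε) :
    closure (holes Ω F ε) = ⋃ k ∈ holeIndices Ω F ε, scaledCopy ε k (closure F) := by
  have := (finite_holeIndices (F := F) hΩ hε).closure_biUnion fun k => scaledCopy ε k F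
  simp only [closure_scaledCopy hε] at this
  exact this

theorem closure_holes_subset (hΩ : Bornology.IsBounded Ω) (hε : 0 < ε) :
    closure (holes Ω F ε) ⊆ Ω := by
  rw [closure_holes hΩ hε]
  refine iUnion₂_subset fun k hk => ?_
  rw [← closure_scaledCopy hε]
  exact hk.2

theorem isOpen_holes (hF : IsOpen F) (hε : 0 < ε) : IsOpen (holes Ω F ε) :=
  isOpen_biUnion fun k _ => by
    rw [scaledCopy_eq_image_dilation hε]
    exact (Homeomorph.isOpenMap _) _ hF

theorem isOpen_perforated (hΩ : IsOpen Ω) : IsOpen (perforated Ω F ε) :=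
  hΩ.sdiff isClosed_closure

theorem frontier_holes_subset (hΩ : Bornology.IsBounded Ω) (hF : IsOpen F) (hε : 0 < ε) :
    frontier (holes Ω F ε) ⊆ ⋃ k ∈ holeIndices Ω F ε, scaledCopy ε k (frontier F) := by
  rw [(isOpen_holes hF hε).frontier_eq, closure_holes hΩ hε]
  rintro x ⟨hx, hxF⟩
  simp only [mem_iUnion] at hx ⊢
  obtain ⟨k, hk, y, hy, rfl⟩ := hx
  refine ⟨k, hk, y, ?_, rfl⟩
  rw [hF.frontier_eq]
  exact ⟨hy, fun hyF => hxF (mem_biUnion hk ⟨y, hyF, rfl⟩)⟩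

/-- A collar avoids its own closed hole by definition and every other one by disjointness of the
thickenings. -/
theorem scaledCopy_outerCollar_subset (hΩ : Bornology.IsBounded Ω) (hε : 0 < ε) {δ : ℝ}
    (hδ : 0 < δ)
    (hdisj : ∀ k l : Fin N → ℤ, k ≠ l →
      Disjoint (scaledCopy ε k (Metric.thickening δ (closure F)))
        (scaledCopy ε l (Metric.thickening δ (closure F)))) (k : Fin N → ℤ) :
    Ω ∩ scaledCopy ε k (outerCollar δ F) ⊆ perforated Ω F ε := by
  rintro x ⟨hxΩ, hx⟩
  refine ⟨hxΩ, fun hmem => ?_⟩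
  rw [closure_holes hΩ hε] at hmem
  simp only [mem_iUnion] at hmem
  obtain ⟨l, -, hl⟩ := hmem
  rcases eq_or_ne k l with rfl | hkl
  · have h1 := mem_inter hx hl
    rw [scaledCopy_eq_image_dilation hε, scaledCopy_eq_image_dilation hε,
      ← image_inter (Homeomorph.injective _)] at h1
    obtain ⟨y, hy, -⟩ := h1
    exact hy.1.2 hy.2
  · exact disjoint_left.1 (hdisj k l hkl) (image_mono sdiff_subset hx)
      (image_mono (Metric.self_subset_thickening hδ _) hl)

/-- The closed holes lie inside `Ω`, so `Ω` is unperforated near its boundary. Convergence of traces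
on the full frontier thus restricts to `∂Ω`. -/
theorem frontier_subset_frontier_perforated (hΩo : IsOpen Ω) (hΩ : Bornology.IsBounded Ω)
    (hε : 0 < ε) : frontier Ω ⊆ frontier (perforated Ω F ε) := by
  intro x hx
  rw [hΩo.frontier_eq] at hx
  rw [(isOpen_perforated hΩo).frontier_eq]
  refine ⟨?_, fun h => hx.2 h.1⟩
  have hopen : IsOpen (closure (holes Ω F ε))ᶜ := isClosed_closure.isOpen_compl
  have hsub : (closure (holes Ω F ε))ᶜ ∩ Ω ⊆ perforated Ω F ε := fun y hy => ⟨hy.2, hy.1⟩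
  exact closure_mono hsub
    (hopen.inter_closure ⟨fun h => hx.2 (closure_holes_subset hΩ hε h), hx.1⟩)

theorem frontier_subset_closure_outerCollar (hF : IsOpen F) (hbdry : HasC1Boundary F) {δ : ℝ}
    (hδ : 0 < δ) : frontier F ⊆ closure (outerCollar δ F) := by
  intro x hx
  obtain ⟨r, hr, n, γ, hn, hγ, hloc⟩ := hbdry x hx
  have htend : Tendsto (fun t : ℝ => x - t • n) (𝓝[>] 0) (𝓝 x) := by
    have : Continuous fun t : ℝ => x - t • n := by fun_prop
    simpa using (this.tendsto 0).mono_left nhdsWithin_le_nhds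
  refine mem_closure_of_tendsto htend ?_
  filter_upwards [Ioo_mem_nhdsGT (lt_min hδ (half_pos hr))] with t ht
  refine ⟨Metric.mem_thickening_iff.2 ⟨x, frontier_subset_closure hx, ?_⟩,
    sub_smul_notMem_closure hF hn hγ.continuous hloc
      (Metric.mem_closedBall_self (half_pos hr).le) hx ht.1 (ht.2.trans_le (min_le_right _ _))⟩
  rw [dist_eq_norm]
  simpa [norm_smul, hn, abs_of_pos ht.1] using ht.2.trans_le (min_le_left _ _)

/-- One-sidedness of the `C¹` boundary matters: each boundary point of a hole is a limit of points
of its outer collar, which lies in the perforated domain near that point. -/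
theorem frontier_holes_subset_frontier_perforated (hΩo : IsOpen Ω) (hΩ : Bornology.IsBounded Ω)
    (hF : IsOpen F) (hbdry : HasC1Boundary F) (hε : 0 < ε) {δ : ℝ} (hδ : 0 < δ)
    (hdisj : ∀ k l : Fin N → ℤ, k ≠ l →
      Disjoint (scaledCopy ε k (Metric.thickening δ (closure F)))
        (scaledCopy ε l (Metric.thickening δ (closure F)))) :
    frontier (holes Ω F ε) ⊆ frontier (perforated Ω F ε) := by
  intro x hx
  rw [(isOpen_perforated hΩo).frontier_eq]
  refine ⟨?_, fun h => h.2 (frontier_subset_closure hx)⟩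
  have hxΩ : x ∈ Ω := closure_holes_subset hΩ hε (frontier_subset_closure hx)
  have hx' := frontier_holes_subset hΩ hF hε hx
  simp only [mem_iUnion] at hx'
  obtain ⟨k, -, hk⟩ := hx'
  have h1 : x ∈ closure (scaledCopy ε k (outerCollar δ F)) := by
    rw [closure_scaledCopy hε]
    exact image_mono (frontier_subset_closure_outerCollar hF hbdry hδ) hk
  exact closure_mono (scaledCopy_outerCollar_subset hΩ hε hδ hdisj k)
    (hΩo.inter_closure ⟨hxΩ, h1⟩)

end Perforated

/-! ### Summation over the holes -/

section Estimate

variable {d : ℕ}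

/-- The quantifier order is the point: `C` is fixed before `Ω` and `ε`, whereas `M` counts the holes
and so follows them. -/
theorem exists_lintegral_frontier_holes_le {F : Set (EuclideanSpace ℝ (Fin (d + 1)))}
    (hF : IsOpen F) (hFY : closure F ⊆ unitCell (d + 1)) (hbdry : HasC1Boundary F)
    {δ : ℝ} (hδ : 0 < δ)
    (hdisj : ∀ ε : ℝ, 0 < ε → ∀ k l : Fin (d + 1) → ℤ, k ≠ l →
      Disjoint (scaledCopy ε k (Metric.thickening δ (closure F)))
        (scaledCopy ε l (Metric.thickening δ (closure F))))
    {p : ℝ} (hp : 1 ≤ p) :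
    ∃ C : NNReal, ∀ Ω : Set (EuclideanSpace ℝ (Fin (d + 1))), IsOpen Ω →
      Bornology.IsBounded Ω → ∀ ε : ℝ, 0 < ε → ∃ M : NNReal,
      ∀ u : EuclideanSpace ℝ (Fin (d + 1)) → ℝ, ContDiff ℝ 1 u →
        ENNReal.ofReal ε * ∫⁻ x in frontier (holes Ω F ε), ‖u x‖ₑ ^ p
            ∂(Measure.euclideanHausdorffMeasure d) ≤
          C * (∫⁻ x in perforated Ω F ε,
            (‖u x‖ₑ ^ p + ENNReal.ofReal ε ^ p * ‖fderiv ℝ u x‖ₑ ^ p)) +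
          M * ∫⁻ x in frontier Ω, ‖u x‖ₑ ^ p ∂(Measure.euclideanHausdorffMeasure d) := by
  have : Fact (Module.finrank ℝ (EuclideanSpace ℝ (Fin (d + 1))) = d + 1) := ⟨by simp⟩
  have hFc : IsCompact (closure F) := isCompact_of_subset_unitCell isClosed_closure hFY
  obtain ⟨C, hC⟩ := exists_lintegral_frontier_le (d := d) hF
    (hFc.of_isClosed_subset isClosed_frontier frontier_subset_closure) hbdry hδ hp
  refine ⟨C, fun Ω hΩo hΩ ε hε => ?_⟩
  set I : Finset (Fin (d + 1) → ℤ) := (finite_holeIndices (F := F) hΩ hε).toFinset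
  refine ⟨I.card * (C * ε.toNNReal), fun u hu => ?_⟩
  set e := ENNReal.ofReal ε
  set R := outerCollar δ F
  have hRm : MeasurableSet R := (isOpen_outerCollar δ F).measurableSet
  set f : EuclideanSpace ℝ (Fin (d + 1)) → ℝ≥0∞ :=
    fun x => ‖u x‖ₑ ^ p + e ^ p * ‖fderiv ℝ u x‖ₑ ^ p
  set J := ∫⁻ x in frontier Ω, ‖u x‖ₑ ^ p ∂(Measure.euclideanHausdorffMeasure d)
  have hcov : frontier (holes Ω F ε) ⊆ ⋃ k : I, scaledCopy ε (k : Fin (d + 1) → ℤ) (frontier F) := by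
    intro x hx
    have := frontier_holes_subset hΩ hF hε hx
    simp only [mem_iUnion] at this ⊢
    obtain ⟨k, hk, hx⟩ := this
    exact ⟨⟨k, (Finite.mem_toFinset _).2 hk⟩, hx⟩
  have hk : ∀ k ∈ I, e * ∫⁻ x in scaledCopy ε k (frontier F), ‖u x‖ₑ ^ p
      ∂(Measure.euclideanHausdorffMeasure d) ≤
        C * ((∫⁻ x in Ω ∩ scaledCopy ε k R, f x) + e * J) := by
    intro k hk
    have hk' : k ∈ holeIndices Ω F ε := (Finite.mem_toFinset _).1 hk
    refine lintegral_frontier_dilation_le hRm hp hC (ε • latticeVec k) hε hΩo ?_ hu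
    rw [← scaledCopy_eq_image_dilation, ← closure_scaledCopy hε]
    exact hk'.2
  have hpd : (I : Set (Fin (d + 1) → ℤ)).PairwiseDisjoint fun k => Ω ∩ scaledCopy ε k R :=
    fun k _ l _ hkl => (hdisj ε hε k l hkl).mono
      (inter_subset_right.trans (image_mono sdiff_subset))
      (inter_subset_right.trans (image_mono sdiff_subset))
  have hsum : ∑ k ∈ I, ∫⁻ x in Ω ∩ scaledCopy ε k R, f x ≤ ∫⁻ x in perforated Ω F ε, f x := by
    rw [← lintegral_biUnion_finset hpd fun k _ => hΩo.measurableSet.inter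
      ((dilation (ε • latticeVec k) hε).measurableEmbedding.measurableSet_image.2 hRm)]
    exact lintegral_mono_set (iUnion₂_subset fun k _ =>
      scaledCopy_outerCollar_subset hΩ hε hδ (hdisj ε hε) k)
  calc e * ∫⁻ x in frontier (holes Ω F ε), ‖u x‖ₑ ^ p ∂(Measure.euclideanHausdorffMeasure d)
      ≤ e * ∑ k ∈ I, ∫⁻ x in scaledCopy ε k (frontier F), ‖u x‖ₑ ^ p
          ∂(Measure.euclideanHausdorffMeasure d) := by
        gcongr
        refine (lintegral_mono_set hcov).trans ((lintegral_iUnion_le _ _).trans ?_)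
        rw [tsum_fintype, ← Finset.sum_coe_sort I]
    _ ≤ ∑ k ∈ I, C * ((∫⁻ x in Ω ∩ scaledCopy ε k R, f x) + e * J) := by
        rw [Finset.mul_sum]
        exact Finset.sum_le_sum hk
    _ = C * (∑ k ∈ I, ∫⁻ x in Ω ∩ scaledCopy ε k R, f x) + I.card * (C * e) * J := by
        rw [← Finset.mul_sum, Finset.sum_add_distrib, Finset.sum_const, nsmul_eq_mul]
        ring
    _ ≤ _ := by
        gcongr
        push_cast
        rfl

end Estimate

/-! ### Passage from smooth functions to `W^{1,p}` -/

section Limit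

theorem tendsto_eLpNorm_of_tendsto_eLpNorm_sub {α E ι : Type*} [MeasurableSpace α]
    [NormedAddCommGroup E] {μ : Measure α} {q : ℝ≥0∞} (hq : 1 ≤ q) {l : Filter ι} {u : ι → α → E}
    {v : α → E} (hu : ∀ i, AEStronglyMeasurable (u i) μ) (hv : AEStronglyMeasurable v μ)
    (h : Tendsto (fun i => eLpNorm (u i - v) q μ) l (𝓝 0)) :
    Tendsto (fun i => eLpNorm (u i) q μ) l (𝓝 (eLpNorm v q μ)) := by
  have h1 : Tendsto (fun i => eLpNorm v q μ - eLpNorm (u i - v) q μ) l (𝓝 (eLpNorm v q μ)) := by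
    simpa using ENNReal.Tendsto.sub tendsto_const_nhds h (Or.inr ENNReal.zero_ne_top)
  have h2 : Tendsto (fun i => eLpNorm v q μ + eLpNorm (u i - v) q μ) l (𝓝 (eLpNorm v q μ)) := by
    simpa using tendsto_const_nhds.add h
  refine tendsto_of_tendsto_of_tendsto_of_le_of_le h1 h2 (fun i => ?_) fun i => ?_
  · refine tsub_le_iff_right.2 ?_
    have := eLpNorm_sub_le (hu i) ((hu i).sub hv) hq
    rwa [sub_sub_cancel] at this
  · have := eLpNorm_add_le hv ((hu i).sub hv) hq
    rwa [add_sub_cancel] at this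

theorem eLpNorm_ofReal_rpow {α E : Type*} [MeasurableSpace α] [NormedAddCommGroup E]
    {μ : Measure α} {p : ℝ} (hp : 1 ≤ p) (f : α → E) :
    eLpNorm f (ENNReal.ofReal p) μ ^ p = ∫⁻ x, ‖f x‖ₑ ^ p ∂μ := by
  have hp0 : 0 < p := by linarith
  rw [eLpNorm_eq_lintegral_rpow_enorm_toReal (by simpa using hp0) ENNReal.ofReal_ne_top,
    ENNReal.toReal_ofReal hp0.le, ← ENNReal.rpow_mul, one_div, inv_mul_cancel₀ hp0.ne',
    ENNReal.rpow_one]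

theorem enorm_gradient {E : Type*} [NormedAddCommGroup E] [InnerProductSpace ℝ E]
    [CompleteSpace E] (u : E → ℝ) (x : E) : ‖gradient u x‖ₑ = ‖fderiv ℝ u x‖ₑ := by
  rw [gradient, LinearIsometryEquiv.enorm_map]

theorem continuous_gradient {E : Type*} [NormedAddCommGroup E] [InnerProductSpace ℝ E]
    [CompleteSpace E] {u : E → ℝ} (hu : ContDiff ℝ 1 u) : Continuous (gradient u) :=
  (InnerProductSpace.toDual ℝ E).symm.continuous.comp (hu.continuous_fderiv one_ne_zero)

end Limit

theorem mainTheorem5 (N : ℕ) (hN : 2 ≤ N)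
    (F : Set (EuclideanSpace ℝ (Fin N))) (hFopen : IsOpen F)
    (hFY : closure F ⊆ unitCell N) (hFbdry : HasC1Boundary F)
    (hFdisj : ∀ k : Fin N → ℤ, k ≠ 0 → Disjoint (closure F) (closure (scaledCopy 1 k F)))
    (p : ℝ) (hp : 1 ≤ p) :
    ∃ C : ℝ, 0 < C ∧
      ∀ Ω : Set (EuclideanSpace ℝ (Fin N)), IsOpen Ω → IsConnected Ω → Bornology.IsBounded Ω →
        HasC1Boundary Ω →
      ∀ ε : ℝ, 0 < ε →
      ∀ (v : EuclideanSpace ℝ (Fin N) → ℝ)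
        (gradv : EuclideanSpace ℝ (Fin N) → EuclideanSpace ℝ (Fin N)),
        IsW1p (ENNReal.ofReal p) (perforated Ω F ε) v gradv →
      ∀ γv : EuclideanSpace ℝ (Fin N) → ℝ,
        IsTrace (ENNReal.ofReal p) (perforated Ω F ε) v gradv γv →
        (∀ᵐ x ∂(surfaceMeasure (frontier Ω)), γv x = 0) →
        ENNReal.ofReal ε *
            eLpNorm γv (ENNReal.ofReal p) (surfaceMeasure (frontier (holes Ω F ε))) ^ p ≤
          ENNReal.ofReal C *
            (eLpNorm v (ENNReal.ofReal p) (volume.restrict (perforated Ω F ε)) ^ p +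
              ENNReal.ofReal (ε ^ p) *
                eLpNorm gradv (ENNReal.ofReal p) (volume.restrict (perforated Ω F ε)) ^ p) := by
  obtain ⟨d, rfl⟩ : ∃ d, N = d + 1 := ⟨N - 1, by omega⟩
  have hp0 : 0 < p := by linarith
  obtain ⟨δ, hδ, hdisj⟩ := exists_disjoint_scaledCopy_thickening
    (isCompact_of_subset_unitCell isClosed_closure hFY) fun k hk => by
      rw [← closure_scaledCopy one_pos]; exact hFdisj k hk
  obtain ⟨C, hC⟩ := exists_lintegral_frontier_holes_le hFopen hFY hFbdry hδ hdisj hp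
  -- `C` may be zero; adding `1` makes the constant positive.
  refine ⟨C + 1, by positivity, fun Ω hΩo _ hΩ _ ε hε v gradv hv γv htr hγ0 => ?_⟩
  obtain ⟨M, hM⟩ := hC Ω hΩo hΩ ε hε
  obtain ⟨hγ, u, hu, huv, hugrad, huγ⟩ := htr
  have hq : 1 ≤ ENNReal.ofReal p := by simpa using hp
  have hu1 : ∀ m, ContDiff ℝ 1 (u m) := fun m => (hu m).of_le (by exact_mod_cast le_top)
  have hrestrict : ∀ T, T ⊆ frontier (perforated Ω F ε) →
      surfaceMeasure T ≤ surfaceMeasure (frontier (perforated Ω F ε)) :=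
    fun T hT => Measure.restrict_mono hT le_rfl
  have hΩsub := hrestrict _ (frontier_subset_frontier_perforated (F := F) hΩo hΩ hε)
  have hHsub := hrestrict _
    (frontier_holes_subset_frontier_perforated hΩo hΩ hFopen hFbdry hε hδ (hdisj ε hε))
  have hsub : ∀ μ : Measure (EuclideanSpace ℝ (Fin (d + 1))),
      μ ≤ surfaceMeasure (frontier (perforated Ω F ε)) →
      Tendsto (fun m => eLpNorm (u m) (ENNReal.ofReal p) μ ^ p) atTop
        (𝓝 (eLpNorm γv (ENNReal.ofReal p) μ ^ p)) := fun μ hμ =>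
    ((tendsto_eLpNorm_of_tendsto_eLpNorm_sub hq
      (fun m => (hu m).continuous.aestronglyMeasurable) (hγ.1.mono_measure hμ)
      (tendsto_of_tendsto_of_tendsto_of_le_of_le tendsto_const_nhds huγ (fun _ => zero_le)
        fun m => eLpNorm_mono_measure _ hμ))).ennrpow_const p
  have hlim1 := hsub _ hHsub
  have hlim2 := hsub _ hΩsub
  -- The zero trace enters here and removes the term carrying `M` in the limit.
  have hγ0' : eLpNorm γv (ENNReal.ofReal p) (surfaceMeasure (frontier Ω)) ^ p = 0 := by
    rw [eLpNorm_congr_ae (g := fun _ => 0) hγ0]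
    simp [hp0]
  rw [hγ0'] at hlim2
  have hlim3 := (tendsto_eLpNorm_of_tendsto_eLpNorm_sub hq
    (fun m => (hu m).continuous.aestronglyMeasurable) hv.memLp.1 huv).ennrpow_const p
  have hlim4 := (tendsto_eLpNorm_of_tendsto_eLpNorm_sub hq
    (fun m => (continuous_gradient (hu1 m)).aestronglyMeasurable) hv.memLp_grad.1
    hugrad).ennrpow_const p
  have hineq : ∀ m, ENNReal.ofReal ε *
      eLpNorm (u m) (ENNReal.ofReal p) (surfaceMeasure (frontier (holes Ω F ε))) ^ p ≤
      C * (eLpNorm (u m) (ENNReal.ofReal p) (volume.restrict (perforated Ω F ε)) ^ p +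
        ENNReal.ofReal (ε ^ p) * eLpNorm (gradient (u m)) (ENNReal.ofReal p)
          (volume.restrict (perforated Ω F ε)) ^ p) +
      M * eLpNorm (u m) (ENNReal.ofReal p) (surfaceMeasure (frontier Ω)) ^ p := by
    intro m
    simp only [eLpNorm_ofReal_rpow hp, enorm_gradient]
    have h1 := hM (u m) (hu1 m)
    rw [lintegral_add_left ((hu m).continuous.measurable.enorm.pow_const p),
      lintegral_const_mul' _ _ (by finiteness), ENNReal.ofReal_rpow_of_pos hε] at h1
    exact h1
  have hl := ENNReal.Tendsto.const_mul (a := ENNReal.ofReal ε) hlim1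
    (Or.inr ENNReal.ofReal_ne_top)
  have hr := (ENNReal.Tendsto.const_mul (a := (C : ℝ≥0∞))
    (hlim3.add (ENNReal.Tendsto.const_mul (a := ENNReal.ofReal (ε ^ p)) hlim4
      (Or.inr ENNReal.ofReal_ne_top))) (Or.inr ENNReal.coe_ne_top)).add
    (ENNReal.Tendsto.const_mul (a := (M : ℝ≥0∞)) hlim2 (Or.inr ENNReal.coe_ne_top))
  rw [mul_zero, add_zero] at hr
  refine (le_of_tendsto_of_tendsto' hl hr hineq).trans ?_
  gcongr
  rw [← ENNReal.ofReal_coe_nnreal]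
  exact ENNReal.ofReal_le_ofReal (by linarith)
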